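/- **Setting.** Let $\mathscr K$ be a Noetherian integral domain with fraction field $K$, and let $H$ be a $\mathscr K$-algebra that is finitely generated and torsion-free as a $\mathscr K$-module and such that $H_K=K\otimes_{\mathscr K}H$ is semisimple. Let $\{E_\lambda\}_{\lambda\in\Lambda}$ be representatives of the (finitely many) isomorphism classes of irreducible right $H_K$-modules, and let $\mathrm{ht}:\Lambda\to\mathbb Z$ be any function. Let $\mathscr A$ be the category of right $H$-modules that are finitely generated and torsion-free over $\mathscr K$. For a right $H_K$-module $N$ and $i\in\mathbb Z$, let $N^i$ be the sum of all irreducible submodules of $N$ isomorphic to some $E_\lambda$ with $\mathrm{ht}(\lambda)\le i$; for $M\in\mathscr A$ put $M_K=K\otimes_{\mathscr K}M$ and $M^i=M\cap (M_K)^i$. Every morphism $M\to N$ in $\mathscr A$ induces maps $M^i\to N^i$ and $M^i/M^{i-1}\to N^i/N^{i-1}$. For each $i\in\mathbb Z$ let $\mathscr S_i$ be a full additive subcategory of $\mathscr A$, closed under isomorphism, such that for each $S\in\mathscr S_i$ the $H_K$-module $S_K$ is a direct sum of modules $E_\lambda$ with $\mathrm{ht}(\lambda)=i$. Let $\mathscr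 S=\bigcup_i\mathscr S_i$, and let $\mathscr A(\mathscr S)$ be the full subcategory of those $M\in\mathscr A$ with $M^j/M^{j-1}\in\mathscr S_j$ for all $j\in\mathbb Z$. Let $\mathscr E(\mathscr S)$ be the class of all sequences $X\to Y\to Z$ in $\mathscr A(\mathscr S)$ such that $0\to X\to Y\to Z\to 0$ is an exact sequence of $H$-modules and, for every $i\in\mathbb Z$, the induced sequence $0\to X^i/X^{i-1}\to Y^i/Y^{i-1}\to Z^i/Z^{i-1}\to 0$ is a split short exact sequence of $H$-modules. The pair $(\mathscr A(\mathscr S),\mathscr E(\mathscr S))$ is an exact category. An inflation is the first map $X\to Y$ of a sequence in $\mathscr E(\mathscr S)$. $\mathrm{Ext}^1_{\mathscr E(\mathscr S)}(Z,X)$ is the set of sequences $X\to Y\to Z$ in $\mathscr E(\mathscr S)$, where two sequences with middle terms $Y$, $Y'$ are identified if there is a morphism $Y\to Y'$ compatible with the identities of $X$ and $Z$; its zero element is the class of the split sequence. **Theorem 4.7.** Assume that each $\mathscr S_i$ is strictly generated as an additive category by finitely many objects, i.e., there is a finite set of objects of $\mathscr S_i$ such that every object of $\mathscr S_i$ is isomorphic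 to a finite direct sum (repetitions allowed) of objects in this set. Let $M\in\mathscr A(\mathscr S)$. Then there exist an object $X$ of $\mathscr A(\mathscr S)$ and an inflation $\iota:M\to X$ such that $$\mathrm{Ext}^1_{\mathscr E(\mathscr S)}(S,X)=0\quad\text{for all } S\in\mathscr S,$$ and such that, in addition, if $M\neq0$ and $h$ is the minimal integer with $M^{h-1}\ne0$, then $\iota$ induces an isomorphism $M^{h-1}\cong X^{h-1}$. -/

import Mathlib

open scoped TensorProduct

universe u

namespace ExactStrat

noncomputable section

/-! ### Extension of scalars of right modules

Right modules over a ring `R` are modules over `Rᵐᵒᵖ`. -/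

section BaseChange

variable (𝒦 K H : Type u) [CommRing 𝒦] [Field K] [Algebra 𝒦 K] [Ring H] [Algebra 𝒦 H]
variable (M N : Type u) [AddCommGroup M] [Module 𝒦 M] [Module Hᵐᵒᵖ M] [IsScalarTower 𝒦 Hᵐᵒᵖ M]
variable [AddCommGroup N] [Module 𝒦 N] [Module Hᵐᵒᵖ N] [IsScalarTower 𝒦 Hᵐᵒᵖ N]

/-- The right action of `H_K = K ⊗ H` on `M_K = K ⊗ M`. -/
def baseChangeAction : (K ⊗[𝒦] H)ᵐᵒᵖ →ₐ[𝒦] Module.End 𝒦 (K ⊗[𝒦] M) :=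
  ((Module.endTensorEndAlgHom (R := 𝒦) (S := 𝒦) (A := 𝒦) (M := K) (N := M)).comp
    (Algebra.TensorProduct.map (Algebra.lsmul 𝒦 𝒦 K : Kᵐᵒᵖ →ₐ[𝒦] Module.End 𝒦 K)
      (Algebra.lsmul 𝒦 𝒦 M : Hᵐᵒᵖ →ₐ[𝒦] Module.End 𝒦 M))).comp
    (Algebra.TensorProduct.opAlgEquiv 𝒦 𝒦 K H).symm.toAlgHom

/-- `M_K = K ⊗ M` as a right `H_K`-module. -/
instance baseChangeModule : Module (K ⊗[𝒦] H)ᵐᵒᵖ (K ⊗[𝒦] M) :=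
  Module.compHom (K ⊗[𝒦] M) (baseChangeAction 𝒦 K H M).toRingHom

/-- The action is `(a ⊗ m) · (k ⊗ h) = (a k) ⊗ (m · h)`. -/
theorem baseChange_smul_tmul (k a : K) (h : H) (m : M) :
    (MulOpposite.op (k ⊗ₜ[𝒦] h) : (K ⊗[𝒦] H)ᵐᵒᵖ) • (a ⊗ₜ[𝒦] m) =
      (a * k) ⊗ₜ[𝒦] (MulOpposite.op h • m) := by
  change baseChangeAction 𝒦 K H M (MulOpposite.op (k ⊗ₜ[𝒦] h)) (a ⊗ₜ[𝒦] m) = _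
  simp only [baseChangeAction, AlgHom.comp_apply, AlgEquiv.toAlgHom_apply,
    Algebra.TensorProduct.opAlgEquiv_symm_tmul,
    Algebra.TensorProduct.map_tmul]
  rfl

variable {M N}

/-- The `𝒦`-linear map underlying a map of right `H`-modules. -/
def toBase (f : M →ₗ[Hᵐᵒᵖ] N) : M →ₗ[𝒦] N := f.restrictScalars 𝒦

/-- The map `M_K → N_K` of right `H_K`-modules induced by a map `M → N` of right `H`-modules. -/
def baseChangeMap (f : M →ₗ[Hᵐᵒᵖ] N) :
    (K ⊗[𝒦] M) →ₗ[(K ⊗[𝒦] H)ᵐᵒᵖ] (K ⊗[𝒦] N) where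
  toFun := (toBase 𝒦 H f).lTensor K
  map_add' := map_add _
  map_smul' := by
    intro r x
    obtain ⟨r, rfl⟩ := MulOpposite.op_surjective r
    simp only [RingHom.id_apply]
    induction x using TensorProduct.induction_on with
    | zero => simp
    | add x y hx hy => simp only [smul_add, map_add, hx, hy]
    | tmul a m =>
      induction r using TensorProduct.induction_on with
      | zero => simp
      | add r s hr hs => simp only [MulOpposite.op_add, add_smul, map_add, hr, hs]
      | tmul k h => simp [baseChange_smul_tmul, toBase]

end BaseChange

/-! ### Height functions and the induced filtrations -/

/-- A finite set `Λ` indexing the isomorphism classes of irreducible right `H_K`-modules,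
representatives `E l`, and an integer valued (height) function on `Λ`. -/
structure HeightSystem (𝒦 K H : Type u) [CommRing 𝒦] [Field K] [Algebra 𝒦 K]
    [Ring H] [Algebra 𝒦 H] : Type (u + 1) where
  Λ : Type u
  finite_Λ : Finite Λ
  E : Λ → ModuleCat.{u} (K ⊗[𝒦] H)ᵐᵒᵖ
  simple : ∀ l, IsSimpleModule (K ⊗[𝒦] H)ᵐᵒᵖ (E l)
  eq_of_iso : ∀ l l', Nonempty (E l ≃ₗ[(K ⊗[𝒦] H)ᵐᵒᵖ] E l') → l = l'
  exists_iso : ∀ L : ModuleCat.{u} (K ⊗[𝒦] H)ᵐᵒᵖ, IsSimpleModule (K ⊗[𝒦] H)ᵐᵒᵖ L →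
    ∃ l, Nonempty (L ≃ₗ[(K ⊗[𝒦] H)ᵐᵒᵖ] E l)
  ht : Λ → ℤ

section Filtration

variable {𝒦 K H : Type u} [CommRing 𝒦] [Field K] [Algebra 𝒦 K] [Ring H] [Algebra 𝒦 H]
variable (D : HeightSystem 𝒦 K H)

/-- For a right `H_K`-module `N`, the sum `N^i` of all irreducible submodules isomorphic to some
`E l` with `ht l ≤ i`. -/
def heightPart (i : ℤ) (N : Type u) [AddCommGroup N] [Module (K ⊗[𝒦] H)ᵐᵒᵖ N] :
    Submodule (K ⊗[𝒦] H)ᵐᵒᵖ N :=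
  sSup {L | ∃ l, D.ht l ≤ i ∧ Nonempty (L ≃ₗ[(K ⊗[𝒦] H)ᵐᵒᵖ] D.E l)}

theorem heightPart_mono {i j : ℤ} (hij : i ≤ j) (N : Type u) [AddCommGroup N]
    [Module (K ⊗[𝒦] H)ᵐᵒᵖ N] : heightPart D i N ≤ heightPart D j N :=
  sSup_le_sSup fun _ ⟨l, hl, e⟩ => ⟨l, hl.trans hij, e⟩

theorem map_heightPart_le (i : ℤ) {N N' : Type u} [AddCommGroup N] [Module (K ⊗[𝒦] H)ᵐᵒᵖ N]
    [AddCommGroup N'] [Module (K ⊗[𝒦] H)ᵐᵒᵖ N'] (f : N →ₗ[(K ⊗[𝒦] H)ᵐᵒᵖ] N') :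
    heightPart D i N ≤ (heightPart D i N').comap f := by
  refine sSup_le ?_
  rintro L ⟨l, hl, ⟨e⟩⟩
  have := D.simple l
  have : IsSimpleModule (K ⊗[𝒦] H)ᵐᵒᵖ L := IsSimpleModule.congr e
  rcases LinearMap.injective_or_eq_zero (f.comp L.subtype) with h | h
  · rw [← Submodule.map_le_iff_le_comap]
    refine le_sSup ⟨l, hl, ⟨?_⟩⟩
    exact ((LinearEquiv.ofInjective _ h).trans
      (LinearEquiv.ofEq _ _ (by rw [LinearMap.range_comp, Submodule.range_subtype]))).symm.trans e
  · intro x hx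
    have : f x = 0 := LinearMap.congr_fun h ⟨x, hx⟩
    simp [this]

variable (M N : Type u) [AddCommGroup M] [Module 𝒦 M] [Module Hᵐᵒᵖ M] [IsScalarTower 𝒦 Hᵐᵒᵖ M]
variable [AddCommGroup N] [Module 𝒦 N] [Module Hᵐᵒᵖ N] [IsScalarTower 𝒦 Hᵐᵒᵖ N]

/-- `M^i = M ∩ (M_K)^i`, the inverse image of `(M_K)^i` under `M → M_K`. -/
def filt (i : ℤ) : Submodule Hᵐᵒᵖ M where
  carrier := {m | (1 : K) ⊗ₜ[𝒦] m ∈ heightPart D i (K ⊗[𝒦] M)}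
  add_mem' := by
    intro a b ha hb
    simpa [TensorProduct.tmul_add] using add_mem ha hb
  zero_mem' := by simp
  smul_mem' := by
    intro h m hm
    obtain ⟨h, rfl⟩ := MulOpposite.op_surjective h
    have := Submodule.smul_mem (heightPart D i (K ⊗[𝒦] M))
      (MulOpposite.op ((1 : K) ⊗ₜ[𝒦] h)) hm
    rwa [baseChange_smul_tmul, one_mul] at this

/-- The section `M^i / M^(i-1)`. -/
abbrev gr (i : ℤ) : Type u :=
  filt D M i ⧸ (filt D M (i - 1)).submoduleOf (filt D M i)

variable {M N}

theorem filt_le_comap (f : M →ₗ[Hᵐᵒᵖ] N) (i : ℤ) : filt D M i ≤ (filt D N i).comap f := by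
  intro m hm
  have := map_heightPart_le D i (baseChangeMap 𝒦 K H f) hm
  exact this

/-- The induced map `M^i → N^i`. -/
def filtMap (f : M →ₗ[Hᵐᵒᵖ] N) (i : ℤ) : filt D M i →ₗ[Hᵐᵒᵖ] filt D N i :=
  f.restrict (filt_le_comap D f i)

/-- The induced map `M^i / M^(i-1) → N^i / N^(i-1)`. -/
def grMap (f : M →ₗ[Hᵐᵒᵖ] N) (i : ℤ) : gr D M i →ₗ[Hᵐᵒᵖ] gr D N i :=
  Submodule.mapQ _ _ (filtMap D f i) (fun _ hm => filt_le_comap D f (i - 1) hm)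

end Filtration

/-! ### The categories and their conflations -/

/-- Right `H`-modules (with the induced `𝒦`-module structure). -/
structure RMod (𝒦 H : Type u) [CommRing 𝒦] [Ring H] [Algebra 𝒦 H] : Type (u + 1) where
  carrier : Type u
  [addCommGroup : AddCommGroup carrier]
  [baseModule : Module 𝒦 carrier]
  [module : Module Hᵐᵒᵖ carrier]
  [tower : IsScalarTower 𝒦 Hᵐᵒᵖ carrier]

attribute [instance] RMod.addCommGroup RMod.baseModule RMod.module RMod.tower

instance (𝒦 H : Type u) [CommRing 𝒦] [Ring H] [Algebra 𝒦 H] :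
    CoeSort (RMod 𝒦 H) (Type u) := ⟨RMod.carrier⟩

section Categories

variable {𝒦 K H : Type u} [CommRing 𝒦] [Field K] [Algebra 𝒦 K] [Ring H] [Algebra 𝒦 H]

/-- Membership in `𝒜`: finite and torsion-free over `𝒦`. -/
structure IsLattice (M : RMod 𝒦 H) : Prop where
  finite : Module.Finite 𝒦 M
  torsionFree : Module.IsTorsionFree 𝒦 M

variable (D : HeightSystem 𝒦 K H)

/-- `M_K` is a (finite) direct sum of irreducible right `H_K`-modules of height `i`. -/
def HasPureHeight (i : ℤ) (M : RMod 𝒦 H) : Prop :=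
  ∃ (n : ℕ) (c : Fin n → D.Λ), (∀ k, D.ht (c k) = i) ∧
    Nonempty ((K ⊗[𝒦] M) ≃ₗ[(K ⊗[𝒦] H)ᵐᵒᵖ] (∀ k, D.E (c k)))

/-- The objects satisfying `P` form a full additive (isomorphism closed) subcategory of `𝒜`, all
of whose objects `S` have `S_K` a direct sum of irreducible modules of height `i`. -/
structure IsStratum (i : ℤ) (P : RMod 𝒦 H → Prop) : Prop where
  lattice : ∀ M, P M → IsLattice M
  height : ∀ M, P M → HasPureHeight D i M
  iso_closed : ∀ M N : RMod 𝒦 H, Nonempty (M ≃ₗ[Hᵐᵒᵖ] N) → P M → P N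
  zero_mem : P ⟨PUnit⟩
  sum_mem : ∀ M N : RMod 𝒦 H, P M → P N → P ⟨M × N⟩

/-- `P` is strictly generated by finitely many objects: every object satisfying `P` is isomorphic
to a finite direct sum (repetitions allowed) of members of a fixed finite family in `P`. -/
def StrictlyFinitelyGenerated (P : RMod 𝒦 H → Prop) : Prop :=
  ∃ (n : ℕ) (G : Fin n → RMod 𝒦 H), (∀ k, P (G k)) ∧
    ∀ S, P S → ∃ (m : ℕ) (c : Fin m → Fin n), Nonempty (S ≃ₗ[Hᵐᵒᵖ] (∀ k, G (c k)))

/-- The conflations of `ℰ`: short exact sequences in `𝒜` with exact sections. -/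
structure IsConflation {X Y Z : RMod 𝒦 H} (ι : X →ₗ[Hᵐᵒᵖ] Y) (δ : Y →ₗ[Hᵐᵒᵖ] Z) : Prop where
  left : IsLattice X
  mid : IsLattice Y
  right : IsLattice Z
  injective : Function.Injective ι
  exact : Function.Exact ι δ
  surjective : Function.Surjective δ
  gr_injective : ∀ i, Function.Injective (grMap D ι i)
  gr_exact : ∀ i, Function.Exact (grMap D ι i) (grMap D δ i)
  gr_surjective : ∀ i, Function.Surjective (grMap D δ i)

variable (𝒮 : ℤ → RMod 𝒦 H → Prop)

/-- Membership in `𝒜(𝒮)`: `M` lies in `𝒜` and `M^j / M^(j-1)` lies in `𝒮_j` for all `j`. -/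
structure MemAS (M : RMod 𝒦 H) : Prop where
  lattice : IsLattice M
  gr_mem : ∀ j, 𝒮 j ⟨gr D M j⟩

/-- The conflations of `ℰ(𝒮)`: those of `ℰ` with terms in `𝒜(𝒮)` and split sections. -/
structure IsConflationS {X Y Z : RMod 𝒦 H} (ι : X →ₗ[Hᵐᵒᵖ] Y) (δ : Y →ₗ[Hᵐᵒᵖ] Z) : Prop where
  conflation : IsConflation D ι δ
  left : MemAS D 𝒮 X
  mid : MemAS D 𝒮 Y
  right : MemAS D 𝒮 Z
  split : ∀ i, ∃ s : gr D Z i →ₗ[Hᵐᵒᵖ] gr D Y i, grMap D δ i ∘ₗ s = LinearMap.id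

/-- Inflations of `(𝒜(𝒮), ℰ(𝒮))`. -/
def IsInflationS {X Y : RMod 𝒦 H} (ι : X →ₗ[Hᵐᵒᵖ] Y) : Prop :=
  ∃ (Z : RMod 𝒦 H) (δ : Y →ₗ[Hᵐᵒᵖ] Z), IsConflationS D 𝒮 ι δ

/-- The sequences `X → Y → Z` in `ℰ(𝒮)` with given ends. -/
structure ExtensionS (Z X : RMod 𝒦 H) : Type (u + 1) where
  Y : RMod 𝒦 H
  ι : X →ₗ[Hᵐᵒᵖ] Y
  δ : Y →ₗ[Hᵐᵒᵖ] Z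
  conflation : IsConflationS D 𝒮 ι δ

/-- `Ext¹` of the exact category `(𝒜(𝒮), ℰ(𝒮))`: sequences in `ℰ(𝒮)`, two being identified if
there is a morphism between the middle terms which is compatible with the identities of `X` and
`Z`. For `Z` and `X` in `𝒜(𝒮)` it contains the class of the split sequence, the zero of the Baer
sum, so that `Ext¹ = 0` says that it has at most one element. -/
def Ext1S (Z X : RMod 𝒦 H) : Type (u + 1) :=
  Quot fun e e' : ExtensionS D 𝒮 Z X =>
    ∃ φ : e.Y →ₗ[Hᵐᵒᵖ] e'.Y, φ ∘ₗ e.ι = e'.ι ∧ e'.δ ∘ₗ φ = e.δ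

end Categories

end

end ExactStrat

/-!
Write `S_K` for `K ⊗ S`. Since `H_K` is semisimple, the height parts `N^i` of `H_K`-modules are
compatible with injections and surjections, and since `K` is flat over `𝒦`, an injection of right
`H`-modules reflects the filtrations `M^i` (`mem_filt_of_injective`).

If `S` lies in `𝒮_i`, a conflation `X → Y → S` only enlarges the filtration from step `i` on, and
as `Y^i / Y^(i-1) → S` splits, it is the pushout of an extension of `S` by `X^(i-1)`. So `Ext¹(S,
X)` vanishes as soon as `Ext¹_H(S, X^(i-1)) → Ext¹_H(S, X)` is zero. By the finite generation of
`𝒮_i` it is enough to treat one object `T` of `𝒮_i`, the sum of the generators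
(`exists_generator`). With a projective presentation `p : P → T`, the condition becomes that every
map `ker p → X` with values in `X^(i-1)` extends to `P` (`KerMapsExtend`,
`KerMapsExtend.exists_lift`).

As `𝒦` is Noetherian, the maps `ker p → X^(i-1)` form a finite `𝒦`-module, with generators `φ_1,
…, φ_m`, say. Pushing out along `(φ_l) : (ker p)^m → X^(i-1)` gives a universal extension `X → X'
→ T^m` for which the condition holds at `i` (`exists_pushout`, `exists_universal_extension`). It
leaves the filtration steps below `i` unchanged, so it can be repeated for increasing `i`,
starting at the minimal `h` with `M^(h-1) ≠ 0` and stopping when the heights are exhausted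
(`exists_iterated_extension`). Composites of inflations obtained in this way are again inflations
(`IsSplitStrictExact.exists_comp`), and `M^(h-1)` is unchanged because only heights `≥ h` have
been used.
-/

namespace ExactStrat

/-! ### Height parts and filtrations -/

section HeightPart

variable {𝒦 K H : Type u} [CommRing 𝒦] [Field K] [Algebra 𝒦 K] [Ring H] [Algebra 𝒦 H]
variable (D : HeightSystem 𝒦 K H)
variable {N N' : Type u} [AddCommGroup N] [Module (K ⊗[𝒦] H)ᵐᵒᵖ N]
variable [AddCommGroup N'] [Module (K ⊗[𝒦] H)ᵐᵒᵖ N']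

theorem mem_heightPart_of_injective [IsSemisimpleRing (K ⊗[𝒦] H)] {i : ℤ}
    {f : N →ₗ[(K ⊗[𝒦] H)ᵐᵒᵖ] N'} (hf : Function.Injective f) {x : N}
    (hx : f x ∈ heightPart D i N') : x ∈ heightPart D i N := by
  obtain ⟨g, hg⟩ := IsSemisimpleModule.extension_property f hf LinearMap.id
  have := map_heightPart_le D i g hx
  rwa [Submodule.mem_comap, ← LinearMap.comp_apply, hg] at this

theorem exists_mem_heightPart_of_surjective [IsSemisimpleRing (K ⊗[𝒦] H)] {i : ℤ}
    {f : N →ₗ[(K ⊗[𝒦] H)ᵐᵒᵖ] N'} (hf : Function.Surjective f) {y : N'}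
    (hy : y ∈ heightPart D i N') : ∃ x ∈ heightPart D i N, f x = y := by
  obtain ⟨g, hg⟩ := IsSemisimpleModule.lifting_property f hf LinearMap.id
  exact ⟨g y, map_heightPart_le D i g hy, LinearMap.congr_fun hg y⟩

theorem heightPart_irreducible_eq_top {i : ℤ} {l : D.Λ} (hl : D.ht l ≤ i) :
    heightPart D i (D.E l) = ⊤ :=
  top_unique (le_sSup ⟨l, hl, ⟨Submodule.topEquiv⟩⟩)

theorem heightPart_irreducible_eq_bot {i : ℤ} {l : D.Λ} (hl : i < D.ht l) :
    heightPart D i (D.E l) = ⊥ := by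
  rw [eq_bot_iff]
  refine sSup_le ?_
  rintro L ⟨l', hl', ⟨e⟩⟩
  have := D.simple l
  rcases eq_bot_or_eq_top L with rfl | rfl
  · exact le_rfl
  · have := D.eq_of_iso l l' ⟨Submodule.topEquiv.symm.trans e⟩
    subst this
    exact absurd hl' (not_le.mpr hl)

theorem heightPart_eq_bot_of_forall_lt {i : ℤ} (h : ∀ l, i < D.ht l) :
    heightPart D i N = ⊥ := by
  rw [eq_bot_iff]
  exact sSup_le fun L ⟨l, hl, _⟩ => absurd hl (not_le.mpr (h l))

variable {i j : ℤ} {n : ℕ} {c : Fin n → D.Λ}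

theorem heightPart_eq_top_of_pure (hc : ∀ k, D.ht (c k) = i)
    (e : N ≃ₗ[(K ⊗[𝒦] H)ᵐᵒᵖ] (∀ k, D.E (c k))) (hij : i ≤ j) :
    heightPart D j N = ⊤ := by
  rw [eq_top_iff]
  intro x _
  have key : e x ∈ heightPart D j (∀ k, D.E (c k)) := by
    rw [← Finset.univ_sum_single (e x)]
    refine Submodule.sum_mem _ fun k _ => ?_
    refine map_heightPart_le D j
      (LinearMap.single (K ⊗[𝒦] H)ᵐᵒᵖ (fun k => (D.E (c k) : Type u)) k)
      (x := e x k) ?_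
    rw [heightPart_irreducible_eq_top D ((hc k).le.trans hij)]
    trivial
  simpa using map_heightPart_le D j e.symm.toLinearMap key

theorem heightPart_eq_bot_of_pure (hc : ∀ k, D.ht (c k) = i)
    (e : N ≃ₗ[(K ⊗[𝒦] H)ᵐᵒᵖ] (∀ k, D.E (c k))) (hij : j < i) :
    heightPart D j N = ⊥ := by
  rw [eq_bot_iff]
  intro x hx
  rw [Submodule.mem_bot, ← e.map_eq_zero_iff]
  ext k
  have := map_heightPart_le D j
    ((LinearMap.proj (R := (K ⊗[𝒦] H)ᵐᵒᵖ) (φ := fun k => (D.E (c k) : Type u)) k) ∘ₗ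
      e.toLinearMap) hx
  rw [Submodule.mem_comap, heightPart_irreducible_eq_bot D (hij.trans_eq (hc k).symm)] at this
  exact this

end HeightPart

section Filtration

variable {𝒦 K H : Type u} [CommRing 𝒦] [Field K] [Algebra 𝒦 K] [Ring H] [Algebra 𝒦 H]
variable (D : HeightSystem 𝒦 K H)
variable {M N : Type u} [AddCommGroup M] [Module 𝒦 M] [Module Hᵐᵒᵖ M] [IsScalarTower 𝒦 Hᵐᵒᵖ M]
variable [AddCommGroup N] [Module 𝒦 N] [Module Hᵐᵒᵖ N] [IsScalarTower 𝒦 Hᵐᵒᵖ N]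

theorem filt_mono {i j : ℤ} (hij : i ≤ j) : filt D M i ≤ filt D M j :=
  fun _ hm => heightPart_mono D hij _ hm

theorem filt_eq_bot_of_heightPart_eq_bot [IsDomain 𝒦] [IsFractionRing 𝒦 K]
    [Module.IsTorsionFree 𝒦 M] {i : ℤ} (h : heightPart D i (K ⊗[𝒦] M) = ⊥) :
    filt D M i = ⊥ := by
  rw [eq_bot_iff]
  intro m hm
  have h1 : TensorProduct.mk 𝒦 K M 1 m = 0 := by
    have : (1 : K) ⊗ₜ[𝒦] m ∈ heightPart D i (K ⊗[𝒦] M) := hm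
    rwa [h] at this
  rw [IsLocalizedModule.eq_zero_iff (nonZeroDivisors 𝒦)] at h1
  obtain ⟨s, hs⟩ := h1
  exact (smul_eq_zero.mp hs).resolve_left (nonZeroDivisors.ne_zero s.2)

theorem filt_eq_top_of_heightPart_eq_top {i : ℤ} (h : heightPart D i (K ⊗[𝒦] M) = ⊤) :
    filt D M i = ⊤ := by
  rw [eq_top_iff]
  intro m _
  change (1 : K) ⊗ₜ[𝒦] m ∈ heightPart D i (K ⊗[𝒦] M)
  rw [h]
  trivial

theorem tmul_mem_heightPart {i : ℤ} {m : M} (hm : m ∈ filt D M i) (a : K) :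
    a ⊗ₜ[𝒦] m ∈ heightPart D i (K ⊗[𝒦] M) := by
  have := Submodule.smul_mem (heightPart D i (K ⊗[𝒦] M))
    (MulOpposite.op (a ⊗ₜ[𝒦] (1 : H))) hm
  rwa [baseChange_smul_tmul, one_mul, MulOpposite.op_one, one_smul] at this

variable [IsSemisimpleRing (K ⊗[𝒦] H)]

theorem mem_filt_of_injective [IsDomain 𝒦] [IsFractionRing 𝒦 K] {i : ℤ} {f : M →ₗ[Hᵐᵒᵖ] N}
    (hf : Function.Injective f) {m : M} (hm : f m ∈ filt D N i) : m ∈ filt D M i := by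
  have : Module.Flat 𝒦 K := IsLocalization.flat K (nonZeroDivisors 𝒦)
  exact mem_heightPart_of_injective D (f := baseChangeMap 𝒦 K H f)
    (Module.Flat.lTensor_preserves_injective_linearMap (toBase 𝒦 H f) hf) hm

/-- If `p` is surjective onto a module which is generically of height at most `i`, and `θ` sends
the kernel of `p` into the `i`-th step of the filtration, then `θ` has image in that step. -/
theorem map_mem_filt_of_ker {T : Type u} [AddCommGroup T] [Module 𝒦 T] [Module Hᵐᵒᵖ T]
    [IsScalarTower 𝒦 Hᵐᵒᵖ T] {i : ℤ} (hT : heightPart D i (K ⊗[𝒦] T) = ⊤)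
    {p : M →ₗ[Hᵐᵒᵖ] T} (hp : Function.Surjective p) {θ : M →ₗ[Hᵐᵒᵖ] N}
    (hθ : ∀ r ∈ LinearMap.ker p, θ r ∈ filt D N i) (m : M) : θ m ∈ filt D N i := by
  let k : LinearMap.ker p →ₗ[Hᵐᵒᵖ] M := (LinearMap.ker p).subtype
  have hex : Function.Exact ((toBase 𝒦 H k).lTensor K) ((toBase 𝒦 H p).lTensor K) := by
    refine lTensor_exact K ?_ hp
    exact LinearMap.exact_subtype_ker_map p
  have hsurj : Function.Surjective (baseChangeMap 𝒦 K H p) :=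
    LinearMap.lTensor_surjective K hp
  obtain ⟨w, hw, hpw⟩ := exists_mem_heightPart_of_surjective D hsurj
    (y := baseChangeMap 𝒦 K H p ((1 : K) ⊗ₜ m)) (hT ▸ Submodule.mem_top)
  obtain ⟨v, hv⟩ := (hex ((1 : K) ⊗ₜ[𝒦] m - w)).mp (by
    rw [map_sub, sub_eq_zero]; exact hpw.symm)
  have hθw := map_heightPart_le D i (baseChangeMap 𝒦 K H θ) hw
  have hθv : baseChangeMap 𝒦 K H θ ((toBase 𝒦 H k).lTensor K v) ∈
      heightPart D i (K ⊗[𝒦] N) := by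
    clear hv
    induction v using TensorProduct.induction_on with
    | zero => simp
    | add x y hx hy => simp only [map_add]; exact add_mem hx hy
    | tmul a r => exact tmul_mem_heightPart D (hθ r r.2) a
  rw [hv, map_sub] at hθv
  have := add_mem hθv hθw
  rwa [sub_add_cancel] at this

end Filtration

/-! ### Strictly exact sequences -/

section ShortExact

variable {𝒦 K H : Type u} [CommRing 𝒦] [Field K] [Algebra 𝒦 K] [Ring H] [Algebra 𝒦 H]
variable (D : HeightSystem 𝒦 K H) (𝒮 : ℤ → RMod 𝒦 H → Prop)

/-- A short exact sequence `0 → X → Y → Z → 0` of right `H`-modules which is strictly exact for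
the height filtrations, in the sense that each `Y^i → Z^i` is surjective. Surjectivity on the
filtration steps, rather than on the sections, is what composes well. -/
structure IsStrictExact {X Y Z : RMod 𝒦 H} (ι : X →ₗ[Hᵐᵒᵖ] Y) (δ : Y →ₗ[Hᵐᵒᵖ] Z) :
    Prop where
  injective : Function.Injective ι
  exact : Function.Exact ι δ
  surjective : Function.Surjective δ
  exists_filt : ∀ i, ∀ z ∈ filt D Z i, ∃ y ∈ filt D Y i, δ y = z

/-- A strictly exact sequence whose sections are split. -/
structure IsSplitStrictExact {X Y Z : RMod 𝒦 H} (ι : X →ₗ[Hᵐᵒᵖ] Y) (δ : Y →ₗ[Hᵐᵒᵖ] Z) : Prop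
    extends IsStrictExact D ι δ where
  split : ∀ i, ∃ s : gr D Z i →ₗ[Hᵐᵒᵖ] gr D Y i, grMap D δ i ∘ₗ s = LinearMap.id

/-- The projection `M^i → M^i / M^(i-1)`. -/
def toGr (M : RMod 𝒦 H) (i : ℤ) : filt D M i →ₗ[Hᵐᵒᵖ] gr D M i :=
  Submodule.mkQ _

theorem toGr_surjective (M : RMod 𝒦 H) (i : ℤ) : Function.Surjective (toGr D M i) :=
  Submodule.mkQ_surjective _

theorem toGr_eq_zero_iff {M : RMod 𝒦 H} {i : ℤ} {m : filt D M i} :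
    toGr D M i m = 0 ↔ (m : M) ∈ filt D M (i - 1) :=
  Submodule.Quotient.mk_eq_zero _

theorem grMap_toGr {M N : RMod 𝒦 H} (f : M →ₗ[Hᵐᵒᵖ] N) {i : ℤ} (m : filt D M i) :
    grMap D f i (toGr D M i m) = toGr D N i (filtMap D f i m) :=
  rfl

theorem IsLattice.of_exact [IsDomain 𝒦] [IsNoetherianRing 𝒦] {X Y Z : RMod 𝒦 H}
    {ι : X →ₗ[Hᵐᵒᵖ] Y} {δ : Y →ₗ[Hᵐᵒᵖ] Z} (hι : Function.Injective ι)
    (h : Function.Exact ι δ) (hX : IsLattice X) (hZ : IsLattice Z) : IsLattice Y := by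
  have := hX.finite
  have := hZ.finite
  have := hX.torsionFree
  have := hZ.torsionFree
  refine ⟨?_, Module.IsTorsionFree.of_smul_eq_zero fun r y hy => ?_⟩
  · have : IsNoetherian 𝒦 Y :=
      isNoetherian_of_range_eq_ker (toBase 𝒦 H ι) (toBase 𝒦 H δ) (by
        ext y; exact (h y).symm)
    infer_instance
  · by_cases hr : r = 0
    · exact Or.inl hr
    right
    have h1 : r • δ y = 0 := by
      have := (toBase 𝒦 H δ).map_smul r y
      rw [hy, map_zero] at this
      exact this.symm
    obtain ⟨x, rfl⟩ := (h y).mp ((smul_eq_zero.mp h1).resolve_left hr)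
    have h2 : ι (r • x) = 0 := by
      exact ((toBase 𝒦 H ι).map_smul r x).trans hy
    rw [map_eq_zero_iff ι hι] at h2
    rw [(smul_eq_zero.mp h2).resolve_left hr, map_zero]

variable {D 𝒮}

namespace IsStrictExact

variable {X Y Z : RMod 𝒦 H} {ι : X →ₗ[Hᵐᵒᵖ] Y} {δ : Y →ₗ[Hᵐᵒᵖ] Z}

theorem gr_surjective (h : IsStrictExact D ι δ) (i : ℤ) :
    Function.Surjective (grMap D δ i) := by
  intro c
  obtain ⟨z, rfl⟩ := toGr_surjective D _ _ c
  obtain ⟨y, hy, hyz⟩ := h.exists_filt i z z.2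
  exact ⟨toGr D Y i ⟨y, hy⟩, congrArg (toGr D Z i) (Subtype.ext hyz)⟩

variable [IsSemisimpleRing (K ⊗[𝒦] H)] [IsDomain 𝒦] [IsFractionRing 𝒦 K]

theorem gr_injective (h : IsStrictExact D ι δ) (i : ℤ) :
    Function.Injective (grMap D ι i) := by
  rw [injective_iff_map_eq_zero]
  intro a ha
  obtain ⟨x, rfl⟩ := toGr_surjective D _ _ a
  rw [grMap_toGr, toGr_eq_zero_iff] at ha
  exact (toGr_eq_zero_iff D).mpr (mem_filt_of_injective D h.injective ha)

theorem gr_exact (h : IsStrictExact D ι δ) (i : ℤ) :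
    Function.Exact (grMap D ι i) (grMap D δ i) := by
  intro b
  constructor
  · intro hb
    obtain ⟨y, rfl⟩ := toGr_surjective D _ _ b
    rw [grMap_toGr, toGr_eq_zero_iff] at hb
    obtain ⟨y', hy', hyy'⟩ := h.exists_filt (i - 1) _ hb
    obtain ⟨x, hx⟩ := (h.exact (y.1 - y')).mp (by
      rw [map_sub, hyy']; exact sub_self _)
    have hxi : x ∈ filt D X i := mem_filt_of_injective D h.injective (by
      rw [hx]; exact sub_mem y.2 (filt_mono D (by omega) hy'))
    refine ⟨toGr D X i ⟨x, hxi⟩, ?_⟩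
    rw [grMap_toGr, ← sub_eq_zero, ← map_sub, toGr_eq_zero_iff]
    change ι x - y.1 ∈ filt D Y (i - 1)
    rw [hx, sub_sub_cancel_left]
    exact neg_mem hy'
  · rintro ⟨a, rfl⟩
    obtain ⟨x, rfl⟩ := toGr_surjective D _ _ a
    rw [grMap_toGr, grMap_toGr, toGr_eq_zero_iff]
    change δ (ι x.1) ∈ filt D Z (i - 1)
    rw [h.exact.apply_apply_eq_zero]
    exact zero_mem _

end IsStrictExact

namespace IsSplitStrictExact

variable {X Y Z : RMod 𝒦 H} {ι : X →ₗ[Hᵐᵒᵖ] Y} {δ : Y →ₗ[Hᵐᵒᵖ] Z}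
variable [IsSemisimpleRing (K ⊗[𝒦] H)] [IsDomain 𝒦] [IsFractionRing 𝒦 K]

theorem memAS_mid [IsNoetherianRing 𝒦] (h𝒮 : ∀ i, IsStratum D i (𝒮 i))
    (h : IsSplitStrictExact D ι δ) (hX : MemAS D 𝒮 X) (hZ : MemAS D 𝒮 Z) : MemAS D 𝒮 Y := by
  refine ⟨.of_exact h.injective h.exact hX.lattice hZ.lattice, fun j => ?_⟩
  obtain ⟨e, -⟩ := ((h.gr_exact j).split_tfae (h.gr_injective j)
    (h.gr_surjective j)).out 0 2 |>.mp (h.split j)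
  exact (h𝒮 j).iso_closed _ _ ⟨e.symm⟩ ((h𝒮 j).sum_mem _ _ (hX.gr_mem j) (hZ.gr_mem j))

theorem isConflationS [IsNoetherianRing 𝒦] (h𝒮 : ∀ i, IsStratum D i (𝒮 i))
    (h : IsSplitStrictExact D ι δ) (hX : MemAS D 𝒮 X) (hZ : MemAS D 𝒮 Z) :
    IsConflationS D 𝒮 ι δ where
  conflation :=
    { left := hX.lattice
      mid := (h.memAS_mid h𝒮 hX hZ).lattice
      right := hZ.lattice
      injective := h.injective
      exact := h.exact
      surjective := h.surjective
      gr_injective := h.gr_injective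
      gr_exact := h.gr_exact
      gr_surjective := h.gr_surjective }
  left := hX
  mid := h.memAS_mid h𝒮 hX hZ
  right := hZ
  split := h.split

/-- Admissible monomorphisms compose: if `X → Y` and `Y → W` have cokernels `Z` and `V`, then
`U = W / X` is an extension of `V` by `Z`. -/
theorem exists_comp [IsNoetherianRing 𝒦] (h𝒮 : ∀ i, IsStratum D i (𝒮 i))
    (h : IsSplitStrictExact D ι δ) (hZ : MemAS D 𝒮 Z)
    {W V : RMod 𝒦 H} {ι' : Y →ₗ[Hᵐᵒᵖ] W} {δ' : W →ₗ[Hᵐᵒᵖ] V}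
    (h' : IsSplitStrictExact D ι' δ') (hV : MemAS D 𝒮 V) :
    ∃ (U : RMod 𝒦 H) (ε : W →ₗ[Hᵐᵒᵖ] U),
      MemAS D 𝒮 U ∧ IsSplitStrictExact D (ι' ∘ₗ ι) ε := by
  let R := LinearMap.range (ι' ∘ₗ ι)
  let U : RMod 𝒦 H := ⟨W ⧸ R⟩
  let ε : W →ₗ[Hᵐᵒᵖ] U := R.mkQ
  let π : U →ₗ[Hᵐᵒᵖ] V := R.liftQ δ' (by
    rintro _ ⟨x, rfl⟩
    exact h'.exact.apply_apply_eq_zero _)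
  have hπε : ∀ w, π (ε w) = δ' w := fun w => rfl
  -- `κ` is the inclusion of `Z = Y / X` into `U = W / X`.
  let κ₀ : (Y ⧸ LinearMap.ker δ) →ₗ[Hᵐᵒᵖ] U := (LinearMap.ker δ).liftQ (ε ∘ₗ ι') (by
    intro y hy
    obtain ⟨x, rfl⟩ := (h.exact y).mp hy
    exact (Submodule.Quotient.mk_eq_zero _).mpr ⟨x, rfl⟩)
  let κ : Z →ₗ[Hᵐᵒᵖ] U := κ₀ ∘ₗ (δ.quotKerEquivOfSurjective h.surjective).symm.toLinearMap
  have hκ : ∀ y, κ (δ y) = ε (ι' y) := by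
    intro y
    have : (δ.quotKerEquivOfSurjective h.surjective).symm (δ y) = (LinearMap.ker δ).mkQ y := by
      rw [LinearEquiv.symm_apply_eq]; rfl
    change κ₀ ((δ.quotKerEquivOfSurjective h.surjective).symm (δ y)) = _
    rw [this]; rfl
  have hεex : Function.Exact (ι' ∘ₗ ι) ε := LinearMap.exact_map_mkQ_range _
  have hinj : Function.Injective (ι' ∘ₗ ι) := h'.injective.comp h.injective
  have hεs : Function.Surjective ε := R.mkQ_surjective
  have hκinj : Function.Injective κ := by
    rw [injective_iff_map_eq_zero]
    intro z hz
    obtain ⟨y, rfl⟩ := h.surjective z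
    rw [hκ] at hz
    obtain ⟨x, hx⟩ := (hεex _).mp hz
    rw [← h'.injective hx]
    exact h.exact.apply_apply_eq_zero x
  have hκex : Function.Exact κ π := by
    intro u
    constructor
    · intro hu
      obtain ⟨w, rfl⟩ := hεs u
      obtain ⟨y, rfl⟩ := (h'.exact w).mp hu
      exact ⟨δ y, hκ y⟩
    · rintro ⟨z, rfl⟩
      obtain ⟨y, rfl⟩ := h.surjective z
      rw [hκ, hπε]
      exact h'.exact.apply_apply_eq_zero _
  have hKU : IsSplitStrictExact D κ π := by
    refine ⟨⟨hκinj, hκex, fun v => ?_, fun i v hv => ?_⟩, fun i => ?_⟩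
    · obtain ⟨w, rfl⟩ := h'.surjective v
      exact ⟨ε w, rfl⟩
    · obtain ⟨w, hw, rfl⟩ := h'.exists_filt i v hv
      exact ⟨ε w, filt_le_comap D ε i hw, rfl⟩
    · obtain ⟨s, hs⟩ := h'.split i
      refine ⟨grMap D ε i ∘ₗ s, ?_⟩
      have : grMap D π i ∘ₗ grMap D ε i = grMap D δ' i := by
        refine LinearMap.ext fun a => ?_
        obtain ⟨w, rfl⟩ := Submodule.mkQ_surjective _ a
        rfl
      rw [← LinearMap.comp_assoc, this, hs]
  have hfilt : ∀ i, ∀ u ∈ filt D U i, ∃ w ∈ filt D W i, ε w = u := by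
    intro i u hu
    obtain ⟨w, rfl⟩ := hεs u
    obtain ⟨w', hw', hww'⟩ := h'.exists_filt i (δ' w) (filt_le_comap D π i hu)
    obtain ⟨y, hy⟩ := (h'.exact (w - w')).mp (by rw [map_sub, hww', sub_self])
    have hz : δ y ∈ filt D Z i := mem_filt_of_injective D hκinj (by
      rw [hκ, hy, map_sub]
      exact sub_mem hu (filt_le_comap D ε i hw'))
    obtain ⟨y₁, hy₁, hyy₁⟩ := h.exists_filt i _ hz
    refine ⟨w' + ι' y₁, add_mem hw' (filt_le_comap D ι' i hy₁), ?_⟩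
    rw [map_add, ← hκ, hyy₁, hκ, hy, map_sub, add_sub_cancel]
  have hW : IsStrictExact D (ι' ∘ₗ ι) ε := ⟨hinj, hεex, hεs, hfilt⟩
  refine ⟨U, ε, hKU.memAS_mid h𝒮 hZ hV, hW, fun i => ?_⟩
  -- A composite of retractions retracts `gr X → gr W`; exactness turns it into a section.
  obtain ⟨r, hr⟩ := ((h.gr_exact i).split_tfae (h.gr_injective i)
    (h.gr_surjective i)).out 0 1 |>.mp (h.split i)
  obtain ⟨r', hr'⟩ := ((h'.gr_exact i).split_tfae (h'.gr_injective i)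
    (h'.gr_surjective i)).out 0 1 |>.mp (h'.split i)
  have hiff := ((hW.gr_exact i).split_tfae (hW.gr_injective i)
    (hW.gr_surjective i)).out 0 1
  refine hiff.mpr ⟨r ∘ₗ r', ?_⟩
  have : grMap D (ι' ∘ₗ ι) i = grMap D ι' i ∘ₗ grMap D ι i := by
    refine LinearMap.ext fun a => ?_
    obtain ⟨x, rfl⟩ := toGr_surjective D _ _ a
    rfl
  rw [this]
  exact LinearMap.ext fun a =>
    (congrArg r (LinearMap.congr_fun hr' _)).trans (LinearMap.congr_fun hr a)

end IsSplitStrictExact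

end ShortExact

/-! ### Strata and pushout extensions -/

section Stratum

variable {𝒦 K H : Type u} [CommRing 𝒦] [Field K] [Algebra 𝒦 K] [Ring H] [Algebra 𝒦 H]
variable {D : HeightSystem 𝒦 K H} {𝒮 : ℤ → RMod 𝒦 H → Prop}

theorem gr_subsingleton {M : RMod 𝒦 H} {i : ℤ} (h : filt D M i ≤ filt D M (i - 1)) :
    Subsingleton (gr D M i) := by
  refine subsingleton_of_forall_eq 0 fun a => ?_
  obtain ⟨m, rfl⟩ := toGr_surjective D _ _ a
  exact (toGr_eq_zero_iff D).mpr (h m.2)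

namespace IsStratum

variable {i j : ℤ} {P : RMod 𝒦 H → Prop}

theorem heightPart_eq_top (hP : IsStratum D i P) {T : RMod 𝒦 H} (hT : P T) (hij : i ≤ j) :
    heightPart D j (K ⊗[𝒦] T) = ⊤ := by
  obtain ⟨n, c, hc, ⟨e⟩⟩ := hP.height T hT
  exact heightPart_eq_top_of_pure D hc e hij

theorem filt_eq_top (hP : IsStratum D i P) {T : RMod 𝒦 H} (hT : P T) (hij : i ≤ j) :
    filt D T j = ⊤ :=
  filt_eq_top_of_heightPart_eq_top D (hP.heightPart_eq_top hT hij)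

theorem filt_eq_bot [IsDomain 𝒦] [IsFractionRing 𝒦 K] (hP : IsStratum D i P) {T : RMod 𝒦 H}
    (hT : P T) (hij : j < i) : filt D T j = ⊥ := by
  have := (hP.lattice T hT).torsionFree
  obtain ⟨n, c, hc, ⟨e⟩⟩ := hP.height T hT
  exact filt_eq_bot_of_heightPart_eq_bot D (heightPart_eq_bot_of_pure D hc e hij)

/-- The identification of an object of the `i`-th stratum with its `i`-th section. -/
theorem exists_equiv_gr [IsDomain 𝒦] [IsFractionRing 𝒦 K] (hP : IsStratum D i P)
    {T : RMod 𝒦 H} (hT : P T) :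
    ∃ e : T ≃ₗ[Hᵐᵒᵖ] gr D T i, ∀ t : filt D T i, e t = toGr D T i t := by
  let f : T →ₗ[Hᵐᵒᵖ] gr D T i :=
    toGr D T i ∘ₗ (LinearEquiv.ofTop _ (hP.filt_eq_top hT le_rfl)).symm.toLinearMap
  refine ⟨LinearEquiv.ofBijective f ⟨?_, ?_⟩, fun t => rfl⟩
  · rw [injective_iff_map_eq_zero]
    intro t ht
    have := (toGr_eq_zero_iff D).mp ht
    rwa [hP.filt_eq_bot hT (sub_one_lt i)] at this
  · exact (toGr_surjective D T i).comp (LinearEquiv.surjective _)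

theorem gr_subsingleton_of_ne [IsDomain 𝒦] [IsFractionRing 𝒦 K] (hP : IsStratum D i P)
    {T : RMod 𝒦 H} (hT : P T) (hij : j ≠ i) : Subsingleton (gr D T j) := by
  refine gr_subsingleton ?_
  rcases lt_or_gt_of_ne hij with h | h
  · rw [hP.filt_eq_bot hT h]
    exact bot_le
  · rw [hP.filt_eq_top hT (show i ≤ j - 1 by omega)]
    exact le_top

theorem pi_mem (hP : IsStratum D i P) {n : ℕ} (S : Fin n → RMod 𝒦 H) (hS : ∀ k, P (S k)) :
    P ⟨∀ k, S k⟩ := by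
  induction n with
  | zero =>
    refine hP.iso_closed _ _ ⟨?_⟩ hP.zero_mem
    exact LinearEquiv.ofSubsingleton _ _
  | succ n ih =>
    refine hP.iso_closed ⟨S 0 × ∀ k : Fin n, S k.succ⟩ _ ⟨?_⟩
      (hP.sum_mem _ _ (hS 0) (ih _ fun k => hS k.succ))
    exact Fin.consLinearEquiv Hᵐᵒᵖ fun k => (S k : Type u)

end IsStratum

variable [IsDomain 𝒦] [IsFractionRing 𝒦 K]

theorem memAS_of_mem_stratum (h𝒮 : ∀ i, IsStratum D i (𝒮 i)) {i : ℤ} {T : RMod 𝒦 H}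
    (hT : 𝒮 i T) : MemAS D 𝒮 T := by
  refine ⟨(h𝒮 i).lattice T hT, fun j => ?_⟩
  by_cases hij : j = i
  · subst hij
    obtain ⟨e, -⟩ := (h𝒮 j).exists_equiv_gr hT
    exact (h𝒮 j).iso_closed _ _ ⟨e⟩ hT
  · have := (h𝒮 i).gr_subsingleton_of_ne hT hij
    exact (h𝒮 j).iso_closed _ _ ⟨LinearEquiv.ofSubsingleton _ _⟩ (h𝒮 j).zero_mem

/-- Let `p : P → T` be surjective with `T` in the `i`-th stratum. The pushout of `X` along a map
`Φ : ker p → X` with values in `X^(i-1)` is a strictly exact extension of `T` by `X` with split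
sections. -/
theorem exists_pushout [IsSemisimpleRing (K ⊗[𝒦] H)]
    (h𝒮 : ∀ i, IsStratum D i (𝒮 i)) {i : ℤ} {X T P : RMod 𝒦 H} (hT : 𝒮 i T)
    {p : P →ₗ[Hᵐᵒᵖ] T} (hp : Function.Surjective p) (Φ : LinearMap.ker p →ₗ[Hᵐᵒᵖ] X)
    (hΦ : ∀ r, Φ r ∈ filt D X (i - 1)) :
    ∃ (X' : RMod 𝒦 H) (ι : X →ₗ[Hᵐᵒᵖ] X') (δ : X' →ₗ[Hᵐᵒᵖ] T) (θ : P →ₗ[Hᵐᵒᵖ] X'),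
      IsSplitStrictExact D ι δ ∧ ∀ r : LinearMap.ker p, θ r = ι (Φ r) := by
  -- `X'` is the quotient of `X × P` by the elements `(Φ r, -r)`.
  let N : Submodule Hᵐᵒᵖ (X × P) := LinearMap.range (Φ.prod (-(LinearMap.ker p).subtype))
  let X' : RMod 𝒦 H := ⟨(X × P) ⧸ N⟩
  let q : (X × P) →ₗ[Hᵐᵒᵖ] X' := N.mkQ
  have hq : Function.Surjective q := N.mkQ_surjective
  have hq0 : ∀ z, q z = 0 ↔ z ∈ N := fun z => Submodule.Quotient.mk_eq_zero N
  let ι : X →ₗ[Hᵐᵒᵖ] X' := q ∘ₗ LinearMap.inl _ _ _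
  let θ : P →ₗ[Hᵐᵒᵖ] X' := q ∘ₗ LinearMap.inr _ _ _
  let δ : X' →ₗ[Hᵐᵒᵖ] T := N.liftQ (p ∘ₗ LinearMap.snd _ _ _) (by
    rintro _ ⟨r, rfl⟩
    have : p r.1 = 0 := r.2
    simp [this])
  have hqe : ∀ x f, q (x, f) = ι x + θ f := by
    intro x f
    change q (x, f) = q (x, 0) + q (0, f)
    rw [← map_add]; simp
  have hδθ : ∀ f, δ (θ f) = p f := fun f => rfl
  have hδι : ∀ x, δ (ι x) = 0 := fun x => map_zero p
  have hθ : ∀ r : LinearMap.ker p, θ r = ι (Φ r) := by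
    intro r
    rw [← sub_eq_zero, ← neg_eq_zero, neg_sub]
    change q (Φ r, 0) - q (0, (r : P)) = 0
    rw [← map_sub, hq0]
    exact ⟨r, by simp⟩
  -- `ker p` has image in `X^(i-1)` and `P / ker p = T` is of height `i`.
  have hθi : ∀ f, θ f ∈ filt D X' i := by
    refine map_mem_filt_of_ker D ((h𝒮 i).heightPart_eq_top hT le_rfl) hp fun r hr => ?_
    rw [hθ ⟨r, hr⟩]
    exact filt_mono D (by omega) (filt_le_comap D ι _ (hΦ ⟨r, hr⟩))
  have hse : IsStrictExact D ι δ := by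
    refine ⟨?_, ?_, ?_, ?_⟩
    · rw [injective_iff_map_eq_zero]
      intro x hx
      obtain ⟨r, hr⟩ := (hq0 _).mp hx
      have h1 : Φ r = x := congrArg Prod.fst hr
      have h2 : -(r : P) = 0 := congrArg Prod.snd hr
      have h3 : r = 0 := Subtype.ext (neg_eq_zero.mp h2)
      rw [← h1, h3, map_zero]
    · intro y
      constructor
      · intro hy
        obtain ⟨⟨x, f⟩, rfl⟩ := hq y
        have hf : p f = 0 := hy
        exact ⟨x + Φ ⟨f, hf⟩, by rw [map_add, hqe, ← hθ]⟩
      · rintro ⟨x, rfl⟩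
        exact hδι x
    · intro t
      obtain ⟨f, rfl⟩ := hp t
      exact ⟨θ f, rfl⟩
    · intro j t ht
      rcases lt_or_ge j i with hji | hij
      · rw [(h𝒮 i).filt_eq_bot hT hji, Submodule.mem_bot] at ht
        exact ⟨0, zero_mem _, by rw [ht, map_zero]⟩
      · obtain ⟨f, rfl⟩ := hp t
        exact ⟨θ f, filt_mono D hij (hθi f), rfl⟩
  refine ⟨X', ι, δ, θ, ⟨hse, fun j => ?_⟩, hθ⟩
  by_cases hji : j = i
  · subst hji
    -- `θ` induces a map on `T = P / ker p`, because it maps `ker p` into `X^(j-1)`.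
    obtain ⟨e, he⟩ := (h𝒮 j).exists_equiv_gr hT
    let θ₁ : P →ₗ[Hᵐᵒᵖ] gr D X' j := toGr D X' j ∘ₗ θ.codRestrict _ hθi
    let σ₀ : (P ⧸ LinearMap.ker p) →ₗ[Hᵐᵒᵖ] gr D X' j := (LinearMap.ker p).liftQ θ₁ (by
      intro r hr
      refine (toGr_eq_zero_iff D).mpr ?_
      change θ r ∈ _
      rw [hθ ⟨r, hr⟩]
      exact filt_le_comap D ι _ (hΦ ⟨r, hr⟩))
    refine ⟨σ₀ ∘ₗ (p.quotKerEquivOfSurjective hp).symm.toLinearMap ∘ₗ e.symm.toLinearMap, ?_⟩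
    refine LinearMap.ext fun a => ?_
    obtain ⟨t, rfl⟩ := e.surjective a
    obtain ⟨f, rfl⟩ := hp t
    have h1 : (p.quotKerEquivOfSurjective hp).symm (p f) = (LinearMap.ker p).mkQ f := by
      rw [LinearEquiv.symm_apply_eq]; rfl
    change grMap D δ j (σ₀ ((p.quotKerEquivOfSurjective hp).symm (e.symm (e (p f))))) = e (p f)
    rw [e.symm_apply_apply, h1]
    exact (he (filtMap D δ j ⟨θ f, hθi f⟩)).symm
  · have := (h𝒮 i).gr_subsingleton_of_ne hT hji
    exact ⟨0, LinearMap.ext fun a => Subsingleton.elim _ _⟩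

end Stratum

/-! ### Universal extensions and lifting -/

section Extension

variable {𝒦 K H : Type u} [CommRing 𝒦] [Field K] [Algebra 𝒦 K] [Ring H] [Algebra 𝒦 H]
variable {D : HeightSystem 𝒦 K H} {𝒮 : ℤ → RMod 𝒦 H → Prop}

variable (D) in
/-- Every map from `ker p` to `X` with values in `X^(i-1)` extends along `ker p ⊆ P`. If `p` is onto
`T` and `P` is projective, this says that `Ext¹_H(T, X^(i-1)) → Ext¹_H(T, X)` is
zero. -/
def KerMapsExtend {P T : RMod 𝒦 H} (p : P →ₗ[Hᵐᵒᵖ] T) (i : ℤ) (X : RMod 𝒦 H) : Prop :=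
  ∀ φ : LinearMap.ker p →ₗ[Hᵐᵒᵖ] X, (∀ r, φ r ∈ filt D X (i - 1)) →
    ∃ ψ : P →ₗ[Hᵐᵒᵖ] X, ∀ r : LinearMap.ker p, ψ r = φ r

theorem KerMapsExtend.of_filt_eq_bot {P T X : RMod 𝒦 H} (p : P →ₗ[Hᵐᵒᵖ] T) {i : ℤ}
    (h : filt D X (i - 1) = ⊥) : KerMapsExtend D p i X := by
  intro φ hφ
  refine ⟨0, fun r => ?_⟩
  have := hφ r
  rw [h, Submodule.mem_bot] at this
  rw [this, LinearMap.zero_apply]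

theorem KerMapsExtend.of_subsingleton {P T : RMod 𝒦 H} (X : RMod 𝒦 H) [Subsingleton T]
    (p : P →ₗ[Hᵐᵒᵖ] T) (i : ℤ) : KerMapsExtend D p i X := fun φ _ =>
  ⟨φ ∘ₗ LinearMap.id.codRestrict (LinearMap.ker p) fun _ => Subsingleton.elim _ _, fun _ => rfl⟩

/-- A map with values in the image of an injective `ι` factors through `ι`. -/
theorem exists_factor_of_injective {A X Y : RMod 𝒦 H} {ι : X →ₗ[Hᵐᵒᵖ] Y}
    (hι : Function.Injective ι) (φ : A →ₗ[Hᵐᵒᵖ] Y) (hφ : ∀ a, ∃ x, ι x = φ a) :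
    ∃ φ₀ : A →ₗ[Hᵐᵒᵖ] X, ∀ a, ι (φ₀ a) = φ a := by
  refine ⟨(LinearEquiv.ofInjective ι hι).symm.toLinearMap ∘ₗ
    φ.codRestrict (LinearMap.range ι) hφ, fun a => ?_⟩
  exact congrArg Subtype.val
    ((LinearEquiv.ofInjective ι hι).apply_symm_apply (φ.codRestrict (LinearMap.range ι) hφ a))

variable [IsDomain 𝒦] [IsFractionRing 𝒦 K] [IsSemisimpleRing (K ⊗[𝒦] H)]

/-- Extending by an object of the `i`-th stratum does not change the lower filtration steps. -/
theorem IsStrictExact.exists_filt_left (h𝒮 : ∀ i, IsStratum D i (𝒮 i)) {X Y T : RMod 𝒦 H}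
    {ι : X →ₗ[Hᵐᵒᵖ] Y} {δ : Y →ₗ[Hᵐᵒᵖ] T} (h : IsStrictExact D ι δ) {i j : ℤ} (hT : 𝒮 i T)
    (hji : j < i) {y : Y} (hy : y ∈ filt D Y j) : ∃ x ∈ filt D X j, ι x = y := by
  have h1 := filt_le_comap D δ j hy
  rw [(h𝒮 i).filt_eq_bot hT hji] at h1
  obtain ⟨x, rfl⟩ := (h.exact y).mp h1
  exact ⟨x, mem_filt_of_injective D h.injective hy, rfl⟩

theorem KerMapsExtend.of_strictExact (h𝒮 : ∀ i, IsStratum D i (𝒮 i)) {X Y T : RMod 𝒦 H}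
    {ι : X →ₗ[Hᵐᵒᵖ] Y} {δ : Y →ₗ[Hᵐᵒᵖ] T} (h : IsStrictExact D ι δ) {i j : ℤ} (hT : 𝒮 i T)
    (hji : j ≤ i) {Q S : RMod 𝒦 H} {p : Q →ₗ[Hᵐᵒᵖ] S} (hX : KerMapsExtend D p j X) :
    KerMapsExtend D p j Y := by
  intro φ hφ
  have hlift := fun r => h.exists_filt_left h𝒮 hT (show j - 1 < i by omega) (hφ r)
  obtain ⟨φ₀, hφ₀⟩ := exists_factor_of_injective (A := ⟨LinearMap.ker p⟩) h.injective φ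
    fun r => (hlift r).imp fun _ hx => hx.2
  obtain ⟨ψ, hψ⟩ := hX φ₀ fun r => mem_filt_of_injective D h.injective (by
    rw [hφ₀]; exact hφ r)
  exact ⟨ι ∘ₗ ψ, fun r => by rw [LinearMap.comp_apply, hψ, hφ₀]⟩

/-- The universal extension: pushing out along a finite generating family of the `𝒦`-module of maps
`ker p → X^(i-1)` makes all of these maps extend to `P`. -/
theorem exists_universal_extension [IsNoetherianRing 𝒦] (h𝒮 : ∀ i, IsStratum D i (𝒮 i)) {i : ℤ}
    {X T P : RMod 𝒦 H} (hX : IsLattice X) (hT : 𝒮 i T) [Module.Finite 𝒦 P]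
    {p : P →ₗ[Hᵐᵒᵖ] T} (hp : Function.Surjective p) :
    ∃ (X' T' : RMod 𝒦 H) (ι : X →ₗ[Hᵐᵒᵖ] X') (δ : X' →ₗ[Hᵐᵒᵖ] T'),
      𝒮 i T' ∧ IsSplitStrictExact D ι δ ∧ KerMapsExtend D p i X' := by
  have := hX.finite
  let A : Submodule Hᵐᵒᵖ X := filt D X (i - 1)
  let R : Submodule Hᵐᵒᵖ P := LinearMap.ker p
  have : Module.Finite 𝒦 A := Module.IsNoetherian.finite 𝒦 (A.restrictScalars 𝒦)
  have : Module.Finite 𝒦 R := Module.IsNoetherian.finite 𝒦 (R.restrictScalars 𝒦)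
  have : Module.Finite 𝒦 (R →ₗ[Hᵐᵒᵖ] A) :=
    Module.Finite.of_injective (LinearMap.restrictScalarsₗ 𝒦 Hᵐᵒᵖ R A 𝒦)
      (LinearMap.restrictScalars_injective 𝒦)
  obtain ⟨m, g, hg⟩ := Module.Finite.exists_fin (R := 𝒦) (M := R →ₗ[Hᵐᵒᵖ] A)
  let P' : RMod 𝒦 H := ⟨Fin m → P⟩
  let T' : RMod 𝒦 H := ⟨Fin m → T⟩
  let p' : P' →ₗ[Hᵐᵒᵖ] T' := p.compLeft (Fin m)
  have hp' : Function.Surjective p' := hp.comp_left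
  let ρ : Fin m → LinearMap.ker p' →ₗ[Hᵐᵒᵖ] R := fun l =>
    (LinearMap.proj (R := Hᵐᵒᵖ) (φ := fun _ : Fin m => (P : Type u)) l).restrict
      fun r hr => congrFun hr l
  let Φ : LinearMap.ker p' →ₗ[Hᵐᵒᵖ] X := A.subtype ∘ₗ ∑ l, g l ∘ₗ ρ l
  have hT' : 𝒮 i T' := (h𝒮 i).pi_mem (fun _ => T) fun _ => hT
  obtain ⟨X', ι, δ, θ, hιδ, hθ⟩ := exists_pushout h𝒮 hT' hp' Φ fun r => Subtype.property _
  refine ⟨X', T', ι, δ, hT', hιδ, fun φ hφ => ?_⟩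
  have hlift := fun r => hιδ.exists_filt_left h𝒮 hT' (sub_one_lt i) (hφ r)
  obtain ⟨φ₀, hφ₀⟩ := exists_factor_of_injective (A := ⟨R⟩) hιδ.injective φ
    fun r => (hlift r).imp fun _ hx => hx.2
  let φ₁ : R →ₗ[Hᵐᵒᵖ] A := φ₀.codRestrict A fun r =>
    mem_filt_of_injective D hιδ.injective (by rw [hφ₀]; exact hφ r)
  obtain ⟨a, ha⟩ := (Submodule.mem_span_range_iff_exists_fun 𝒦).mp
    (hg ▸ Submodule.mem_top (x := φ₁))
  let sg : Fin m → P →ₗ[Hᵐᵒᵖ] P' := fun l =>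
    LinearMap.single Hᵐᵒᵖ (fun _ : Fin m => (P : Type u)) l
  refine ⟨∑ l, a l • (θ ∘ₗ sg l), fun r => ?_⟩
  have hker : ∀ l, sg l r ∈ LinearMap.ker p' := by
    intro l
    refine funext fun k => ?_
    change p ((Pi.single l (r : P) : Fin m → P) k) = 0
    by_cases hk : k = l
    · subst hk
      rw [Pi.single_eq_same]
      exact r.2
    · rw [Pi.single_eq_of_ne hk, map_zero]
  have hsg : ∀ l, θ (sg l r) = ι (g l r) := by
    intro l
    rw [hθ ⟨sg l r, hker l⟩]
    congr 1
    have : (∑ k, g k ∘ₗ ρ k) ⟨sg l r, hker l⟩ = g l r := by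
      rw [LinearMap.sum_apply, Finset.sum_eq_single l]
      · exact congrArg (g l) (Subtype.ext (Pi.single_eq_same (M := fun _ => (P : Type u)) l _))
      · intro k _ hk
        refine (congrArg (g k) (Subtype.ext ?_)).trans (map_zero (g k))
        exact Pi.single_eq_of_ne (M := fun _ => (P : Type u)) hk _
      · intro hl
        exact absurd (Finset.mem_univ l) hl
    exact congrArg Subtype.val this
  have hφr : φ r = ι (φ₁ r) := (hφ₀ r).symm
  rw [hφr, ← ha]
  simp only [LinearMap.sum_apply, LinearMap.smul_apply, LinearMap.comp_apply, hsg,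
    Submodule.coe_sum, map_sum]
  exact Finset.sum_congr rfl fun l _ => ((toBase 𝒦 H ι).map_smul (a l) (g l r : X)).symm

/-- If the maps from the kernel of `p : P → T` extend, with `P` projective, then every map from `T`
to the end term `S` of a conflation `X → Y → S` lifts to `Y`. -/
theorem KerMapsExtend.exists_lift (h𝒮 : ∀ i, IsStratum D i (𝒮 i)) {i : ℤ}
    {X Y S T P : RMod 𝒦 H} {p : P →ₗ[Hᵐᵒᵖ] T} (hX : KerMapsExtend D p i X)
    (hp : Function.Surjective p) [Module.Projective Hᵐᵒᵖ P] (hS : 𝒮 i S)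
    {ι : X →ₗ[Hᵐᵒᵖ] Y} {δ : Y →ₗ[Hᵐᵒᵖ] S} (h : IsConflationS D 𝒮 ι δ) (g : T →ₗ[Hᵐᵒᵖ] S) :
    ∃ f : T →ₗ[Hᵐᵒᵖ] Y, δ ∘ₗ f = g := by
  obtain ⟨s, hs⟩ := h.split i
  obtain ⟨e, he⟩ := (h𝒮 i).exists_equiv_gr hS
  obtain ⟨b, hb⟩ := Module.projective_lifting_property (toGr D Y i)
    (s ∘ₗ e.toLinearMap ∘ₗ g ∘ₗ p) (toGr_surjective D Y i)
  have hb' : ∀ f, toGr D Y i (b f) = s (e (g (p f))) := LinearMap.congr_fun hb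
  -- `α` lifts `g ∘ p` to `Y`; on `ker p` it takes values in `Y^(i-1)`, that is in `X^(i-1)`, and it
  -- becomes zero there after subtracting the extension `ψ` of its restriction.
  let α : P →ₗ[Hᵐᵒᵖ] Y := (filt D Y i).subtype ∘ₗ b
  have hα : ∀ f, δ (α f) = g (p f) := by
    intro f
    refine e.injective ?_
    refine (he (filtMap D δ i (b f))).trans ?_
    rw [← grMap_toGr, hb']
    exact LinearMap.congr_fun hs _
  have hαr : ∀ r : LinearMap.ker p, α r ∈ filt D Y (i - 1) := by
    intro r
    refine (toGr_eq_zero_iff D (m := b r)).mp ?_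
    rw [hb', show p r = 0 from r.2, map_zero, map_zero, map_zero]
  obtain ⟨φ, hφ⟩ := exists_factor_of_injective (A := ⟨LinearMap.ker p⟩) h.conflation.injective
    (α ∘ₗ (LinearMap.ker p).subtype) fun r => (h.conflation.exact _).mp (by
      rw [LinearMap.comp_apply, Submodule.subtype_apply, hα, show p r = 0 from r.2, map_zero])
  obtain ⟨ψ, hψ⟩ := hX φ fun r => mem_filt_of_injective D h.conflation.injective (by
    rw [hφ]; exact hαr r)
  let f₀ : (P ⧸ LinearMap.ker p) →ₗ[Hᵐᵒᵖ] Y := (LinearMap.ker p).liftQ (α - ι ∘ₗ ψ) (by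
    intro r hr
    have h1 : ι (ψ r) = α r := (congrArg ι (hψ ⟨r, hr⟩)).trans (hφ ⟨r, hr⟩)
    exact sub_eq_zero.mpr h1.symm)
  refine ⟨f₀ ∘ₗ (p.quotKerEquivOfSurjective hp).symm.toLinearMap, LinearMap.ext fun t => ?_⟩
  obtain ⟨f, rfl⟩ := hp t
  have h1 : (p.quotKerEquivOfSurjective hp).symm (p f) = (LinearMap.ker p).mkQ f := by
    rw [LinearEquiv.symm_apply_eq]; rfl
  change δ (f₀ ((p.quotKerEquivOfSurjective hp).symm (p f))) = g (p f)
  rw [h1]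
  change δ (α f - ι (ψ f)) = _
  rw [map_sub, hα, h.conflation.exact.apply_apply_eq_zero, sub_zero]

omit [IsDomain 𝒦] [IsFractionRing 𝒦 K] [IsSemisimpleRing (K ⊗[𝒦] H)] in
/-- If all conflations with given ends have sections, any two of them are identified in `Ext¹`. -/
theorem subsingleton_ext1S_of_split {Z X : RMod 𝒦 H}
    (h : ∀ e : ExtensionS D 𝒮 Z X, ∃ σ : Z →ₗ[Hᵐᵒᵖ] e.Y, e.δ ∘ₗ σ = LinearMap.id) :
    Subsingleton (Ext1S D 𝒮 Z X) := by
  refine ⟨fun a b => ?_⟩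
  induction a using Quot.ind with | _ e =>
  induction b using Quot.ind with | _ e' =>
  refine Quot.sound ?_
  have he := e.conflation.conflation
  have he' := e'.conflation.conflation
  obtain ⟨ρ, hρ⟩ := ((he.exact.split_tfae he.injective he.surjective).out 0 1).mp (h e)
  obtain ⟨σ, hσ⟩ := h e'
  refine ⟨e'.ι ∘ₗ ρ + σ ∘ₗ e.δ, LinearMap.ext fun x => ?_, LinearMap.ext fun y => ?_⟩
  · have h1 : ρ (e.ι x) = x := LinearMap.congr_fun hρ x
    simp [h1, he.exact.apply_apply_eq_zero]
  · have h1 : e'.δ (σ (e.δ y)) = e.δ y := LinearMap.congr_fun hσ _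
    simp [h1, he'.exact.apply_apply_eq_zero]

end Extension

/-! ### Iteration over the heights -/

section Induction

variable {𝒦 K H : Type u} [CommRing 𝒦] [Field K] [Algebra 𝒦 K] [Ring H] [Algebra 𝒦 H]
variable {D : HeightSystem 𝒦 K H} {𝒮 : ℤ → RMod 𝒦 H → Prop}

/-- A single object `T` of the `i`-th stratum, with a projective presentation, such that the
identity of each object `S` of the stratum is a finite sum of endomorphisms factoring through `T`:
take for `T` the sum of all generators. -/
theorem exists_generator [Module.Finite 𝒦 H] {i : ℤ} {Q : RMod 𝒦 H → Prop}
    (hQ : IsStratum D i Q) (hgen : StrictlyFinitelyGenerated Q) :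
    ∃ (P T : RMod 𝒦 H) (p : P →ₗ[Hᵐᵒᵖ] T), Q T ∧ Function.Surjective p ∧
      Module.Projective Hᵐᵒᵖ P ∧ Module.Finite 𝒦 P ∧
      ∀ S : RMod 𝒦 H, Q S → ∃ (m : ℕ) (a : Fin m → T →ₗ[Hᵐᵒᵖ] S) (b : Fin m → S →ₗ[Hᵐᵒᵖ] T),
        ∑ k, a k ∘ₗ b k = LinearMap.id := by
  obtain ⟨n, G, hG, hS⟩ := hgen
  let T : RMod 𝒦 H := ⟨∀ k, G k⟩
  have hT : Q T := hQ.pi_mem G hG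
  have : Module.Finite 𝒦 T := (hQ.lattice T hT).finite
  have : Module.Finite Hᵐᵒᵖ T := Module.Finite.of_restrictScalars_finite 𝒦 Hᵐᵒᵖ T
  have : Module.Finite 𝒦 Hᵐᵒᵖ := Module.Finite.equiv (MulOpposite.opLinearEquiv 𝒦)
  obtain ⟨r, p, hp⟩ := Module.Finite.exists_fin' Hᵐᵒᵖ T
  refine ⟨⟨Fin r → Hᵐᵒᵖ⟩, T, p, hT, hp, inferInstanceAs (Module.Projective Hᵐᵒᵖ (Fin r → Hᵐᵒᵖ)),
    inferInstanceAs (Module.Finite 𝒦 (Fin r → Hᵐᵒᵖ)), fun S hSQ => ?_⟩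
  obtain ⟨m, c, ⟨e⟩⟩ := hS S hSQ
  let sm : ∀ k : Fin m, G (c k) →ₗ[Hᵐᵒᵖ] (∀ k, G (c k)) := fun k =>
    LinearMap.single Hᵐᵒᵖ (fun k => (G (c k) : Type u)) k
  let pm : ∀ k : Fin m, (∀ k, G (c k)) →ₗ[Hᵐᵒᵖ] G (c k) := fun k =>
    LinearMap.proj (R := Hᵐᵒᵖ) (φ := fun k => (G (c k) : Type u)) k
  let sn : ∀ k : Fin n, G k →ₗ[Hᵐᵒᵖ] T := fun k =>
    LinearMap.single Hᵐᵒᵖ (fun k => (G k : Type u)) k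
  let pn : ∀ k : Fin n, T →ₗ[Hᵐᵒᵖ] G k := fun k =>
    LinearMap.proj (R := Hᵐᵒᵖ) (φ := fun k => (G k : Type u)) k
  refine ⟨m, fun k => e.symm.toLinearMap ∘ₗ sm k ∘ₗ pn (c k),
    fun k => sn (c k) ∘ₗ pm k ∘ₗ e.toLinearMap, LinearMap.ext fun x => e.injective ?_⟩
  have hcancel : ∀ k (y : G (c k)), pn (c k) (sn (c k) y) = y := fun k y =>
    Pi.single_eq_same (M := fun k => (G k : Type u)) (c k) y
  simp only [LinearMap.sum_apply, LinearMap.comp_apply, hcancel, map_sum, LinearMap.id_apply,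
    LinearEquiv.coe_coe, LinearEquiv.apply_symm_apply]
  exact Finset.univ_sum_single (e x)

theorem isSplitStrictExact_id_zero (M : RMod 𝒦 H) :
    IsSplitStrictExact (Y := M) (Z := ⟨PUnit⟩) D LinearMap.id 0 where
  injective := Function.injective_id
  exact := fun y => ⟨fun _ => ⟨y, rfl⟩, fun _ => rfl⟩
  surjective := fun _ => ⟨0, rfl⟩
  exists_filt := fun _ _ _ => ⟨0, zero_mem _, rfl⟩
  split := fun i => by
    have : Subsingleton (gr D (⟨PUnit⟩ : RMod 𝒦 H) i) :=
      gr_subsingleton fun x hx => by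
        rw [Subsingleton.elim x 0]; exact zero_mem _
    exact ⟨0, LinearMap.ext fun a => Subsingleton.elim _ _⟩

variable [IsDomain 𝒦] [IsFractionRing 𝒦 K]

theorem IsStratum.subsingleton_of_forall_ne {i : ℤ} {Q : RMod 𝒦 H → Prop} (hQ : IsStratum D i Q)
    (hi : ∀ l, D.ht l ≠ i) {S : RMod 𝒦 H} (hS : Q S) : Subsingleton S := by
  obtain ⟨n, c, hc, ⟨e⟩⟩ := hQ.height S hS
  have := (hQ.lattice S hS).torsionFree
  -- There are no summands, so that `S_K` is of height `i + 1` as well as of height `i`.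
  have hbot := filt_eq_bot_of_heightPart_eq_bot D
    (heightPart_eq_bot_of_pure D (i := i + 1) (fun k => absurd (hc k) (hi _)) e (lt_add_one i))
  rw [hQ.filt_eq_top hS le_rfl] at hbot
  exact (Submodule.subsingleton_iff Hᵐᵒᵖ).mp (subsingleton_of_bot_eq_top hbot.symm)

variable [IsSemisimpleRing (K ⊗[𝒦] H)]

/-- Universal extensions are performed at the heights `a, a + 1, …, a + n - 1` in turn. Each of them
keeps what has been achieved at smaller heights, since it changes no smaller filtration step. -/
theorem exists_iterated_extension [IsNoetherianRing 𝒦] (h𝒮 : ∀ i, IsStratum D i (𝒮 i))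
    {P T : ℤ → RMod 𝒦 H} (p : ∀ i, P i →ₗ[Hᵐᵒᵖ] T i) (hp : ∀ i, Function.Surjective (p i))
    (hT : ∀ i, 𝒮 i (T i)) (hP : ∀ i, Module.Finite 𝒦 (P i)) {M : RMod 𝒦 H}
    (hM : MemAS D 𝒮 M) {a : ℤ} (ha : ∀ j < a, filt D M (j - 1) = ⊥) (n : ℕ) :
    ∃ (X Z : RMod 𝒦 H) (ι : M →ₗ[Hᵐᵒᵖ] X) (δ : X →ₗ[Hᵐᵒᵖ] Z),
      MemAS D 𝒮 Z ∧ IsSplitStrictExact D ι δ ∧ (∀ j < a + n, KerMapsExtend D (p j) j X) ∧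
      ∀ j < a, ∀ x ∈ filt D X j, ∃ m ∈ filt D M j, ι m = x := by
  induction n with
  | zero =>
    refine ⟨M, ⟨PUnit⟩, LinearMap.id, 0, memAS_of_mem_stratum h𝒮 (h𝒮 0).zero_mem,
      isSplitStrictExact_id_zero M, fun j hj => ?_, fun j _ x hx => ⟨x, hx, rfl⟩⟩
    exact KerMapsExtend.of_filt_eq_bot _ (ha j (by simpa using hj))
  | succ n ih =>
    obtain ⟨X, Z, ι, δ, hZ, hex, hext, hlow⟩ := ih
    have := hP (a + n)
    obtain ⟨X', T', ι', δ', hT', hex', hext'⟩ := exists_universal_extension h𝒮 (i := a + n)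
      (hex.memAS_mid h𝒮 hM hZ).lattice (hT _) (hp _)
    obtain ⟨U, ε, hU, hcomp⟩ := hex.exists_comp h𝒮 hZ hex' (memAS_of_mem_stratum h𝒮 hT')
    refine ⟨X', U, ι' ∘ₗ ι, ε, hU, hcomp, fun j hj => ?_, fun j hj x' hx' => ?_⟩
    · rcases eq_or_ne j (a + n) with rfl | hne
      · exact hext'
      · have hj' : j < a + n := by push_cast at hj; omega
        exact (hext j hj').of_strictExact h𝒮 hex'.toIsStrictExact hT' hj'.le
    · obtain ⟨x, hx, rfl⟩ := hex'.exists_filt_left h𝒮 hT' (show j < a + n by omega) hx'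
      obtain ⟨m, hm, rfl⟩ := hlow j hj x hx
      exact ⟨m, hm, rfl⟩

end Induction

end ExactStrat

theorem theorem4p7 {𝒦 K H : Type u} [CommRing 𝒦] [IsDomain 𝒦] [IsNoetherianRing 𝒦]
    [Field K] [Algebra 𝒦 K] [IsFractionRing 𝒦 K]
    [Ring H] [Algebra 𝒦 H] [Module.Finite 𝒦 H] [Module.IsTorsionFree 𝒦 H]
    [IsSemisimpleRing (K ⊗[𝒦] H)]
    (D : ExactStrat.HeightSystem 𝒦 K H)
    (𝒮 : ℤ → ExactStrat.RMod 𝒦 H → Prop)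
    (h𝒮 : ∀ i, ExactStrat.IsStratum D i (𝒮 i))
    (hgen : ∀ i, ExactStrat.StrictlyFinitelyGenerated (𝒮 i))
    (M : ExactStrat.RMod 𝒦 H) (hM : ExactStrat.MemAS D 𝒮 M) :
    ∃ (X : ExactStrat.RMod 𝒦 H) (ι : M →ₗ[Hᵐᵒᵖ] X),
      ExactStrat.MemAS D 𝒮 X ∧ ExactStrat.IsInflationS D 𝒮 ι ∧
      (∀ i S, 𝒮 i S → Subsingleton (ExactStrat.Ext1S D 𝒮 S X)) ∧
      ∀ h : ℤ, IsLeast {j : ℤ | ExactStrat.filt D M (j - 1) ≠ ⊥} h →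
        Function.Bijective (ExactStrat.filtMap D ι (h - 1)) := by
  open ExactStrat in
  choose P T p hT hp hproj hfin hsum using fun i => exists_generator (h𝒮 i) (hgen i)
  have := D.finite_Λ
  obtain ⟨B, hB⟩ := (Set.finite_range D.ht).bddAbove
  have hB' : ∀ l, D.ht l ≤ B := fun l => hB ⟨l, rfl⟩
  obtain ⟨b, hb⟩ := (Set.finite_range D.ht).bddBelow
  have hb' : ∀ l, b ≤ D.ht l := fun l => hb ⟨l, rfl⟩
  -- Start at the minimal `h` with `M^(h-1) ≠ 0`; there is none if `M = 0`, and any start will do.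
  obtain ⟨a, ha, hah⟩ : ∃ a : ℤ, (∀ j < a, filt D M (j - 1) = ⊥) ∧
      ∀ h, IsLeast {j : ℤ | filt D M (j - 1) ≠ ⊥} h → h = a := by
    by_cases hex : ∃ h, IsLeast {j : ℤ | filt D M (j - 1) ≠ ⊥} h
    · obtain ⟨a, ha⟩ := hex
      refine ⟨a, fun j hj => ?_, fun h hh => hh.unique ha⟩
      by_contra hne
      exact absurd (ha.2 hne) (not_le.mpr hj)
    · refine ⟨b, fun j hj => ?_, fun h hh => absurd ⟨h, hh⟩ hex⟩
      have := hM.lattice.torsionFree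
      refine filt_eq_bot_of_heightPart_eq_bot D (heightPart_eq_bot_of_forall_lt D fun l => ?_)
      have := hb' l
      omega
  obtain ⟨X, Z, ι, δ, hZ, hex, hext, hlow⟩ :=
    exists_iterated_extension h𝒮 p hp hT hfin hM ha (B + 1 - a).toNat
  refine ⟨X, ι, hex.memAS_mid h𝒮 hM hZ, ⟨Z, δ, hex.isConflationS h𝒮 hM hZ⟩, fun i S hS => ?_,
    fun h hh => ⟨?_, ?_⟩⟩
  · have hKX : KerMapsExtend D (p i) i X := by
      by_cases hi : i ≤ B
      · exact hext i (by have := Int.self_le_toNat (B + 1 - a); omega)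
      · have : Subsingleton (T i) := (h𝒮 i).subsingleton_of_forall_ne
          (fun l hl => hi (hl ▸ hB' l)) (hT i)
        exact KerMapsExtend.of_subsingleton X (p i) i
    refine subsingleton_ext1S_of_split fun e => ?_
    obtain ⟨m, α, β, hαβ⟩ := hsum i S hS
    have := hproj i
    choose L hL using fun k => hKX.exists_lift h𝒮 (hp i) hS e.conflation (α k)
    refine ⟨∑ k, L k ∘ₗ β k, ?_⟩
    rw [← hαβ]
    refine LinearMap.ext fun x => ?_
    simp only [LinearMap.comp_apply, LinearMap.sum_apply, map_sum]
    exact Finset.sum_congr rfl fun k _ => LinearMap.congr_fun (hL k) (β k x)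
  · intro x y hxy
    exact Subtype.ext (hex.injective (congrArg Subtype.val hxy))
  · rintro ⟨x, hx⟩
    obtain ⟨m, hm, hmx⟩ := hlow (h - 1) (by rw [hah h hh]; omega) x hx
    exact ⟨⟨m, hm⟩, Subtype.ext hmx⟩
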